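/- **Setting.** Fix a function-free first-order signature with a set $\mathbf P$ of predicate symbols (each with an arity) and an infinite set of constants, which is also the Herbrand universe. An *interpretation* is a set of ground atoms; $\mathcal I$ is the set of all interpretations. An *MKNF interpretation* is a nonempty subset of $\mathcal I$. Fix a description logic, i.e. a set of ontology axioms together with a translation $\phi\mapsto\phi^{\mathrm{fo}}$ of axioms to first-order sentences; $\mathrm{pr}(\cdot)$ denotes the set of predicate symbols occurring in an expression, and $\mathrm{pr}(\phi)=\mathrm{pr}(\phi^{\mathrm{fo}})$. A *literal* is a ground atom $p$ or a default literal $\mathord{\sim}p$ (with $\mathord{\sim}\mathord{\sim}p=p$). A *rule* $r$ has a head $H(r)$, which is a literal, and a body $B(r)$, which is a finite set of literals; it is *positive* if $H(r)$ is an atom and a *fact* if $B(r)=\emptyset$. A *program* is a set of rules. A *hybrid knowledge base* is a pair $\langle\mathcal O,\mathcal P\rangle$ of a set $\mathcal O$ of ontology axioms and a program $\mathcal P$; a *dynamic hybrid knowledge base* is a finite sequence of hybrid knowledge bases. **Dynamic stable models.** Let $\mathcal P=\langle\mathcal P_i\rangle_{i<n}$ be a finite sequence of programs (a dynamic logic program)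 and $I\in\mathcal I$. Write $I\models p$ if $p\in I$, $I\models\mathord{\sim}p$ if $p\notin I$, and $I\models B$ if $I\models L$ for all $L\in B$. An occurrence of a rule $r$ in $\mathcal P_i$ is *rejected* if there are $j\ge i$ and $r'\in\mathcal P_j$ with $H(r)=\mathord{\sim}H(r')$ and $I\models B(r')$. Let $Q$ be the program consisting of all rules with a non-rejected occurrence and of all facts $\mathord{\sim}p$ such that no rule $r$ of any $\mathcal P_i$ satisfies $H(r)=p$ and $I\models B(r)$. Then $I$ is a *dynamic stable model* of $\mathcal P$ if $I\cup\{\mathit{not}_p\mid p\notin I\}$ is the least model of the definite program obtained from $Q$ by replacing every default literal $\mathord{\sim}p$ by a fresh atom $\mathit{not}_p$. **Minimal change updates.** For $I,J,J'\in\mathcal I$ write $J\le_I J'$ if, for every predicate symbol $P$, the set of atoms with predicate $P$ on which $I$ and $J$ differ is included in the set of those on which $I$ and $J'$ differ; $J<_I J'$ means $J\le_I J'$ and not $J'\le_I J$. For $M,N\subseteq\mathcal I$ let $M\oplus N=\bigcup_{I\in M}\{J\in N\mid \neg\exists J'\in N: J'<_I J\}$. For first-order theories $T_0,\dots,T_{n-1}$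 with sets of Herbrand models $\mathsf{mod}(T_i)$, the *minimal change update model* of $\langle T_i\rangle_{i<n}$ is $(\cdots((\mathcal I\oplus\mathsf{mod}(T_0))\oplus\mathsf{mod}(T_1))\oplus\cdots)\oplus\mathsf{mod}(T_{n-1})$, provided that it is nonempty. **Basic dynamic hybrid knowledge bases.** Let $\mathcal K=\langle\mathcal K_i\rangle_{i<n}$, $\mathcal K_i=\langle\mathcal O_i,\mathcal P_i\rangle$. It is *$\mathcal O$-based* if every $\mathcal P_i$ contains only positive facts, *$\mathcal P$-based* if every $\mathcal O_i$ is empty, and *basic* if it is one of the two. An MKNF interpretation $M$ is a *dynamic MKNF model of the basic* $\mathcal K$ if either $\mathcal K$ is $\mathcal O$-based and $M$ is the minimal change update model of $\langle\{\phi^{\mathrm{fo}}\mid\phi\in\mathcal O_i\}\cup\{p\mid p\text{ is a fact in }\mathcal P_i\}\rangle_{i<n}$, or $\mathcal K$ is $\mathcal P$-based and $M=\{J\in\mathcal I\mid I\subseteq J\}$ for some dynamic stable model $I$ of $\langle\mathcal P_i\rangle_{i<n}$. **Splitting.** $U\subseteq\mathbf P$ is a *splitting set* for $\langle\mathcal O,\mathcal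 P\rangle$ if $\mathrm{pr}(\phi)\cap U\ne\emptyset$ implies $\mathrm{pr}(\phi)\subseteq U$ for $\phi\in\mathcal O$, and $\mathrm{pr}(H(r))\cap U\neq\emptyset$ implies $\mathrm{pr}(r)\subseteq U$ for $r\in\mathcal P$. The *bottom* $b_U(\langle\mathcal O,\mathcal P\rangle)$ consists of the axioms and rules all of whose predicate symbols are in $U$, and the *top* $t_U(\langle\mathcal O,\mathcal P\rangle)$ of the remaining ones. For $X\subseteq\mathcal I$, the *reduct* $e_U(\langle\mathcal O,\mathcal P\rangle,X)$ has the ontology of the top, and as rules all $r'$ for which there is a rule $r$ of the top with $H(r')=H(r)$, $B(r')=\{L\in B(r)\mid\mathrm{pr}(L)\cap U=\emptyset\}$ and such that, if $X\ne\emptyset$, every atom $p\in B(r)$ with predicate symbol in $U$ belongs to all $J\in X$, and for every $\mathord{\sim}p\in B(r)$ with predicate symbol in $U$ some $J\in X$ does not contain $p$. These operations are applied to dynamic hybrid knowledge bases componentwise. A *splitting sequence* for $\mathcal K$ is a sequence $\langle U_\alpha\rangle_{\alpha<\mu}$, indexed by the ordinals below an ordinal $\mu>0$, of splitting sets for all $\mathcal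 K_i$, which is monotone, continuous ($U_\alpha=\bigcup_{\beta<\alpha}U_\beta$ for limit $\alpha<\mu$) and satisfies $\bigcup_{\alpha<\mu}U_\alpha=\mathbf P$. **Dynamic MKNF models.** $\mathcal K$ is *reducible relative to $V\subseteq\mathbf P$* if either all rules $r$ of all $\mathcal P_i$ are positive with $\mathrm{pr}(B(r))\subseteq V$, or all $\mathcal O_i$ are empty. A splitting sequence $U=\langle U_\alpha\rangle_{\alpha<\mu}$ for $\mathcal K$ is *update-enabling* if $b_{U_0}(\mathcal K)$ is reducible relative to $\emptyset$ and $t_{U_\alpha}(b_{U_{\alpha+1}}(\mathcal K))$ is reducible relative to $U_\alpha$ whenever $\alpha+1<\mu$; $\mathcal K$ is *updatable* if it has an update-enabling splitting sequence. A *solution* to $\mathcal K$ w.r.t. an update-enabling $U$ is a sequence $\langle X_\alpha\rangle_{\alpha<\mu}$ of MKNF interpretations such that $X_0$ is a dynamic MKNF model of the basic $b_{U_0}(\mathcal K)$; $X_{\alpha+1}$ is a dynamic MKNF model of the basic $e_{U_\alpha}\bigl(b_{U_{\alpha+1}}(\mathcal K),\bigcap_{\eta\le\alpha}X_\eta\bigr)$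 whenever $\alpha+1<\mu$; and $X_\alpha=\mathcal I$ for every limit ordinal $\alpha<\mu$. An MKNF interpretation $M$ is a *dynamic MKNF model* of an updatable $\mathcal K$ if $M=\bigcap_{\alpha<\mu}X_\alpha$ for some solution $\langle X_\alpha\rangle_{\alpha<\mu}$ to $\mathcal K$ w.r.t. some update-enabling splitting sequence. **Theorem (Generalisation of Dynamic Stable Model Semantics).** Let $\mathcal K=\langle\mathcal K_i\rangle_{i<n}$, where $\mathcal K_i=\langle\mathcal O_i,\mathcal P_i\rangle$, be a dynamic hybrid knowledge base such that $\mathcal O_i$ is empty for all $i<n$. Then $\mathcal K$ is updatable, and a set $M\subseteq\mathcal I$ is a dynamic MKNF model of $\mathcal K$ if and only if $M=\{J\in\mathcal I\mid I\subseteq J\}$ for some dynamic stable model $I$ of $\langle\mathcal P_i\rangle_{i<n}$. -/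

import Mathlib

universe u v w

namespace HybridUpdate

/-! ### Function-free first-order syntax with the modal operators of MKNF -/

/-- A function-free first-order signature. There are infinitely many constants, and the set of
constants is the Herbrand universe (standard names assumption). -/
structure Signature where
  Pred : Type u
  arity : Pred → ℕ
  Const : Type v
  infinite_const : Infinite Const

/-- Terms with free variables `x₀, …, xₙ₋₁`. -/
inductive Term (S : Signature.{u, v}) (n : ℕ) : Type v
  | var (x : Fin n) : Term S n
  | const (c : S.Const) : Term S n

/-- MKNF formulae with free variables among `x₀, …, xₙ₋₁`; `ex` binds the last variable.
`know` is the modal operator `K` and `naf` is the modal operator `not`. -/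
inductive Formula (S : Signature.{u, v}) : ℕ → Type (max u v)
  | atom {n : ℕ} (P : S.Pred) (ts : Fin (S.arity P) → Term S n) : Formula S n
  | neg {n : ℕ} (φ : Formula S n) : Formula S n
  | conj {n : ℕ} (φ ψ : Formula S n) : Formula S n
  | ex {n : ℕ} (φ : Formula S (n + 1)) : Formula S n
  | know {n : ℕ} (φ : Formula S n) : Formula S n
  | naf {n : ℕ} (φ : Formula S n) : Formula S n

/-- MKNF sentences: formulae without free variables. -/
abbrev Sentence (S : Signature.{u, v}) : Type (max u v) := Formula S 0

namespace Formula

variable {S : Signature.{u, v}}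

/-- The set of predicate symbols relevant to a formula. -/
def preds : {n : ℕ} → Formula S n → Set S.Pred
  | _, .atom P _ => {P}
  | _, .neg φ => φ.preds
  | _, .conj φ ψ => φ.preds ∪ ψ.preds
  | _, .ex φ => φ.preds
  | _, .know φ => φ.preds
  | _, .naf φ => φ.preds

/-- A formula is first-order if it contains no modal operator. -/
def IsFirstOrder : {n : ℕ} → Formula S n → Prop
  | _, .atom _ _ => True
  | _, .neg φ => φ.IsFirstOrder
  | _, .conj φ ψ => φ.IsFirstOrder ∧ ψ.IsFirstOrder
  | _, .ex φ => φ.IsFirstOrder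
  | _, .know _ => False
  | _, .naf _ => False

end Formula

/-! ### Semantics of MKNF -/

/-- Ground atoms `P(c₁, …, cₖ)`. -/
structure GroundAtom (S : Signature.{u, v}) where
  pred : S.Pred
  args : Fin (S.arity pred) → S.Const

/-- Herbrand interpretations, as sets of ground atoms. -/
abbrev Interp (S : Signature.{u, v}) : Type (max u v) := Set (GroundAtom S)

section Semantics

variable {S : Signature.{u, v}}

/-- A ground atom as a sentence. -/
def GroundAtom.toSentence (p : GroundAtom S) : Sentence S :=
  .atom p.pred fun i => .const (p.args i)

/-- The constant denoted by a term when the variables are replaced by the constants `a`. -/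
def Term.eval {n : ℕ} (a : Fin n → S.Const) : Term S n → S.Const
  | .var x => a x
  | .const c => c

/-- Satisfaction in the MKNF structure `(I, M, N)`, the free variables being replaced by the
constants `a`. -/
def Sat (M N : Set (Interp S)) : {n : ℕ} → Interp S → Formula S n → (Fin n → S.Const) → Prop
  | _, I, .atom P ts, a => (⟨P, fun i => (ts i).eval a⟩ : GroundAtom S) ∈ I
  | _, I, .neg φ, a => ¬ Sat M N I φ a
  | _, I, .conj φ ψ, a => Sat M N I φ a ∧ Sat M N I ψ a
  | _, I, .ex φ, a => ∃ c : S.Const, Sat M N I φ (Fin.snoc a c)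
  | _, _, .know φ, a => ∀ J ∈ M, Sat M N J φ a
  | _, _, .naf φ, a => ∃ J ∈ N, ¬ Sat M N J φ a

/-- `M ⊨ T`: every sentence of `T` is true in `(I, M, M)` for every `I ∈ M`. -/
def Models (M : Set (Interp S)) (T : Set (Sentence S)) : Prop :=
  ∀ φ ∈ T, ∀ I ∈ M, Sat M M I φ Fin.elim0

/-- `mod(T)`: the greatest set of interpretations `M` with `M ⊨ T`, whenever there is one.
It is only used for first-order theories, for which there always is one
(see `isGreatest_mod`). -/
def mod (T : Set (Sentence S)) : Set (Interp S) :=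
  ⋃₀ {M | Models M T}

theorem sat_iff_of_isFirstOrder {n : ℕ} (φ : Formula S n) :
    φ.IsFirstOrder → ∀ (M N M' N' : Set (Interp S)) (I : Interp S) (a : Fin n → S.Const),
      Sat M N I φ a ↔ Sat M' N' I φ a := by
  induction φ with
  | atom P ts => intro _ M N M' N' I a; rfl
  | neg φ ih => intro h M N M' N' I a; exact not_congr (ih h M N M' N' I a)
  | conj φ ψ ih₁ ih₂ =>
    intro h M N M' N' I a
    exact and_congr (ih₁ h.1 M N M' N' I a) (ih₂ h.2 M N M' N' I a)
  | ex φ ih => intro h M N M' N' I a; exact exists_congr fun c => ih h M N M' N' I _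
  | know φ ih => intro h; exact h.elim
  | naf φ ih => intro h; exact h.elim

theorem isGreatest_mod (T : Set (Sentence S)) (hT : ∀ φ ∈ T, φ.IsFirstOrder) :
    IsGreatest {M | Models M T} (mod T) := by
  refine ⟨?_, fun M hM => Set.subset_sUnion_of_mem hM⟩
  rintro φ hφ I ⟨M, hM, hI⟩
  exact (sat_iff_of_isFirstOrder φ (hT φ hφ) _ _ _ _ _ _).1 (hM φ hφ I hI)

/-! ### Minimal change updates of first-order theories -/

/-- The difference in the interpretation of the predicate symbol `P` between `I` and `J`. -/
def diff (P : S.Pred) (I J : Interp S) : Set (GroundAtom S) :=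
  ({p ∈ I | p.pred = P} \ {p ∈ J | p.pred = P}) ∪ ({p ∈ J | p.pred = P} \ {p ∈ I | p.pred = P})

/-- `J` is at least as close to `I` as `J'`. -/
def CloserEq (I J J' : Interp S) : Prop :=
  ∀ P : S.Pred, diff P I J ⊆ diff P I J'

/-- `J` is closer to `I` than `J'`. -/
def Closer (I J J' : Interp S) : Prop :=
  CloserEq I J J' ∧ ¬ CloserEq I J' J

/-- `M ⊕ N`: the elements of `N` that are closest to some element of `M`. -/
def update (M N : Set (Interp S)) : Set (Interp S) :=
  ⋃ I ∈ M, {J ∈ N | ¬ ∃ J' ∈ N, Closer I J' J}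

/-- `(⋯((𝓘 ⊕ M₀) ⊕ M₁) ⊕ ⋯) ⊕ Mₙ₋₁`, where `𝓘` is the set of all interpretations. -/
def updateSeq : {n : ℕ} → (Fin n → Set (Interp S)) → Set (Interp S)
  | 0, _ => Set.univ
  | k + 1, M => update (updateSeq fun i : Fin k => M i.castSucc) (M (Fin.last k))

/-- `M` is the minimal change update model of the sequence of first-order theories `T`. -/
def IsMinimalChangeUpdateModel {n : ℕ} (T : Fin n → Set (Sentence S)) (M : Set (Interp S)) :
    Prop :=
  M = updateSeq (fun i => mod (T i)) ∧ M.Nonempty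

end Semantics

/-! ### Generalised and dynamic logic programs -/

/-- Literals: ground atoms and default literals. -/
inductive Literal (S : Signature.{u, v}) : Type (max u v)
  | pos (p : GroundAtom S) : Literal S
  | dneg (p : GroundAtom S) : Literal S

/-- Ground rules. -/
structure Rule (S : Signature.{u, v}) where
  head : Literal S
  body : Finset (Literal S)

/-- Generalised logic programs. -/
abbrev Program (S : Signature.{u, v}) : Type (max u v) := Set (Rule S)

section Programs

variable {S : Signature.{u, v}}

/-- The predicate symbol of a literal. -/
def Literal.pred : Literal S → S.Pred
  | .pos p => p.pred
  | .dneg p => p.pred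

/-- The default negation of a literal; double default negation is absorbed. -/
def Literal.compl : Literal S → Literal S
  | .pos p => .dneg p
  | .dneg p => .pos p

/-- Truth of a literal in an interpretation. -/
def Literal.Holds (I : Interp S) : Literal S → Prop
  | .pos p => p ∈ I
  | .dneg p => p ∉ I

/-- The translation of literals to MKNF: `p` becomes `K p` and `not p` becomes `not p`. -/
def Literal.toMKNF : Literal S → Sentence S
  | .pos p => .know p.toSentence
  | .dneg p => .naf p.toSentence

/-- The predicate symbols occurring in the body of a rule. -/
def Rule.bodyPreds (r : Rule S) : Set S.Pred := {P | ∃ L ∈ r.body, L.pred = P}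

/-- The predicate symbols occurring in a rule. -/
def Rule.preds (r : Rule S) : Set S.Pred := insert r.head.pred r.bodyPreds

/-- A rule is a fact if its body is empty. -/
def Rule.IsFact (r : Rule S) : Prop := r.body = ∅

/-- A rule is positive if its head is an atom. -/
def Rule.IsPositive (r : Rule S) : Prop := ∃ p, r.head = .pos p

/-- `I ⊨ B(r)`. -/
def Rule.BodyHolds (I : Interp S) (r : Rule S) : Prop := ∀ L ∈ r.body, L.Holds I

/-- Two rules are conflicting if the head of one is the default negation of the head of the
other. -/
def Rule.Conflicts (r r' : Rule S) : Prop := r.head = r'.head.compl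

/-- The least model of the definite program that results from replacing every default literal
`not p` by a fresh atom. The elements of `Literal S` serve as the atoms of the extended
vocabulary: `Literal.pos p` is the atom `p` and `Literal.dneg p` is the fresh atom for `not p`. -/
def leastModel (P : Program S) : Set (Literal S) :=
  ⋂₀ {J | ∀ r ∈ P, (∀ L ∈ r.body, L ∈ J) → r.head ∈ J}

/-- `I' = I ∪ {not_p | p ∉ I}`. -/
def extended (I : Interp S) : Set (Literal S) :=
  {L | (∃ p ∈ I, L = .pos p) ∨ ∃ p ∉ I, L = .dneg p}

/-- The multiset of all rules of a dynamic logic program, as the set of the occurrences `(i, r)`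
of rules `r` in its members `P i`. -/
def allRules {n : ℕ} (P : Fin n → Program S) : Set (Fin n × Rule S) :=
  {o | o.2 ∈ P o.1}

/-- The rule occurrences rejected with respect to `I`: an occurrence of a rule is rejected by a
conflicting rule from the same or a later program whose body is true in `I`. -/
def rejected {n : ℕ} (P : Fin n → Program S) (I : Interp S) : Set (Fin n × Rule S) :=
  {o | o.2 ∈ P o.1 ∧ ∃ j, ∃ r' ∈ P j, o.1 ≤ j ∧ o.2.Conflicts r' ∧ r'.BodyHolds I}

/-- The default assumptions with respect to `I`, as facts. -/
def defaults {n : ℕ} (P : Fin n → Program S) (I : Interp S) : Program S :=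
  {r | ∃ p, r = ⟨.dneg p, ∅⟩ ∧ ¬ ∃ o ∈ allRules P, o.2.head = .pos p ∧ o.2.BodyHolds I}

/-- `I` is a dynamic stable model of the dynamic logic program `P` (refined semantics). -/
def IsDynamicStableModel {n : ℕ} (P : Fin n → Program S) (I : Interp S) : Prop :=
  extended I = leastModel (Prod.snd '' (allRules P \ rejected P I) ∪ defaults P I)

end Programs

/-! ### Hybrid knowledge bases -/

/-- A description logic over a signature: a type of ontology assertions together with a
translation of them into first-order sentences. -/
structure DescriptionLogic (S : Signature.{u, v}) where
  Assertion : Type w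
  toFO : Assertion → Sentence S
  toFO_isFirstOrder : ∀ φ, (toFO φ).IsFirstOrder

/-- A hybrid knowledge base: an ontology and a generalised logic program. -/
structure HybridKB {S : Signature.{u, v}} (D : DescriptionLogic.{u, v, w} S) where
  ontology : Set D.Assertion
  program : Program S

/-- A dynamic hybrid knowledge base of length `n`: a finite sequence of hybrid knowledge bases. -/
abbrev DynamicKB {S : Signature.{u, v}} (D : DescriptionLogic.{u, v, w} S) (n : ℕ) :=
  Fin n → HybridKB D

section Splitting

variable {S : Signature.{u, v}} {D : DescriptionLogic.{u, v, w} S}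

namespace HybridKB

/-- `U` is a splitting set for the hybrid knowledge base `K`. -/
def IsSplittingSet (K : HybridKB D) (U : Set S.Pred) : Prop :=
  (∀ φ ∈ K.ontology, ((D.toFO φ).preds ∩ U).Nonempty → (D.toFO φ).preds ⊆ U) ∧
    ∀ r ∈ K.program, r.head.pred ∈ U → r.preds ⊆ U

/-- The bottom of `K` relative to `U`. -/
def bottom (U : Set S.Pred) (K : HybridKB D) : HybridKB D where
  ontology := {φ ∈ K.ontology | (D.toFO φ).preds ⊆ U}
  program := {r ∈ K.program | r.preds ⊆ U}

/-- The top of `K` relative to `U`. -/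
def top (U : Set S.Pred) (K : HybridKB D) : HybridKB D where
  ontology := K.ontology \ (K.bottom U).ontology
  program := K.program \ (K.bottom U).program

/-- The splitting set reduct of `K` relative to `U` and `X`. -/
def reduct (U : Set S.Pred) (K : HybridKB D) (X : Set (Interp S)) : HybridKB D where
  ontology := (K.top U).ontology
  program := {r' | ∃ r ∈ (K.top U).program,
    Models X {φ | ∃ L ∈ r.body, L.pred ∈ U ∧ φ = L.toMKNF} ∧
    r'.head = r.head ∧ ∀ L, L ∈ r'.body ↔ L ∈ r.body ∧ L.pred ∉ U}

/-- The program contains only positive facts. -/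
def IsOBased (K : HybridKB D) : Prop := ∀ r ∈ K.program, r.IsPositive ∧ r.IsFact

/-- The ontology is empty. -/
def IsPBased (K : HybridKB D) : Prop := K.ontology = ∅

/-- All rules are positive and their bodies only contain predicate symbols from `U`. -/
def IsOReducible (K : HybridKB D) (U : Set S.Pred) : Prop :=
  ∀ r ∈ K.program, r.IsPositive ∧ r.bodyPreds ⊆ U

/-- The ontology is empty. -/
def IsPReducible (K : HybridKB D) : Prop := K.ontology = ∅

/-- The first-order theory formed by the translated ontology and by the ground atoms that are
heads of rules; it is used when the program contains only positive facts. -/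
def theory (K : HybridKB D) : Set (Sentence S) :=
  D.toFO '' K.ontology ∪ {φ | ∃ r ∈ K.program, ∃ p, r.head = .pos p ∧ φ = p.toSentence}

end HybridKB

namespace DynamicKB

variable {n : ℕ}

/-- The bottom of a dynamic hybrid knowledge base relative to `U`. -/
def bottom (U : Set S.Pred) (K : DynamicKB D n) : DynamicKB D n := fun i => (K i).bottom U

/-- The top of a dynamic hybrid knowledge base relative to `U`. -/
def top (U : Set S.Pred) (K : DynamicKB D n) : DynamicKB D n := fun i => (K i).top U

/-- The splitting set reduct of a dynamic hybrid knowledge base relative to `U` and `X`. -/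
def reduct (U : Set S.Pred) (K : DynamicKB D n) (X : Set (Interp S)) : DynamicKB D n :=
  fun i => (K i).reduct U X

/-- `M` is a dynamic MKNF model of the basic dynamic hybrid knowledge base `K`. -/
def IsBasicDynamicMKNFModel (K : DynamicKB D n) (M : Set (Interp S)) : Prop :=
  M.Nonempty ∧
    (((∀ i, (K i).IsOBased) ∧ IsMinimalChangeUpdateModel (fun i => (K i).theory) M) ∨
      ((∀ i, (K i).IsPBased) ∧
        ∃ I : Interp S, IsDynamicStableModel (fun i => (K i).program) I ∧ M = {J | I ⊆ J}))

/-- `K` is reducible relative to `U`. -/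
def IsReducible (K : DynamicKB D n) (U : Set S.Pred) : Prop :=
  (∀ i, (K i).IsOReducible U) ∨ ∀ i, (K i).IsPReducible

/-- The monotone and continuous sequence `⟨U α⟩_{α < μ}` of sets of predicate symbols is a
splitting sequence for every member of `K`. The values `U α` for `α ≥ μ` are irrelevant. -/
structure IsSplittingSequence (K : DynamicKB D n) (μ : Ordinal.{u})
    (U : Ordinal.{u} → Set S.Pred) : Prop where
  pos : 0 < μ
  monotone : ∀ α β, α ≤ β → β < μ → U α ⊆ U β
  continuous : ∀ α < μ, Order.IsSuccLimit α → U α = ⋃ β ∈ Set.Iio α, U β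
  splitting : ∀ i, ∀ α < μ, (K i).IsSplittingSet (U α)
  exhaustive : ⋃ α ∈ Set.Iio μ, U α = Set.univ

/-- `⟨U α⟩_{α < μ}` is an update-enabling splitting sequence for `K`. -/
structure IsUpdateEnabling (K : DynamicKB D n) (μ : Ordinal.{u})
    (U : Ordinal.{u} → Set S.Pred) : Prop where
  isSplittingSequence : K.IsSplittingSequence μ U
  reducible_zero : (K.bottom (U 0)).IsReducible ∅
  reducible_succ : ∀ α, α + 1 < μ → ((K.bottom (U (α + 1))).top (U α)).IsReducible (U α)

/-- `K` is updatable if it has an update-enabling splitting sequence. -/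
def IsUpdatable (K : DynamicKB D n) : Prop :=
  ∃ (μ : Ordinal.{u}) (U : Ordinal.{u} → Set S.Pred), K.IsUpdateEnabling μ U

/-- The sequence `⟨X α⟩_{α < μ}` of MKNF interpretations (nonempty sets of interpretations) is a
solution to `K` with respect to `⟨U α⟩_{α < μ}`. -/
structure IsSolution (K : DynamicKB D n) (μ : Ordinal.{u}) (U : Ordinal.{u} → Set S.Pred)
    (X : Ordinal.{u} → Set (Interp S)) : Prop where
  nonempty : ∀ α < μ, (X α).Nonempty
  zero : (K.bottom (U 0)).IsBasicDynamicMKNFModel (X 0)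
  succ : ∀ α, α + 1 < μ →
    ((K.bottom (U (α + 1))).reduct (U α) (⋂ η ∈ Set.Iic α, X η)).IsBasicDynamicMKNFModel
      (X (α + 1))
  limit : ∀ α < μ, Order.IsSuccLimit α → X α = Set.univ

/-- `M` is a dynamic MKNF model of `K` with respect to `⟨U α⟩_{α < μ}`. -/
def IsDynamicMKNFModelWrt (K : DynamicKB D n) (μ : Ordinal.{u}) (U : Ordinal.{u} → Set S.Pred)
    (M : Set (Interp S)) : Prop :=
  M.Nonempty ∧ ∃ X : Ordinal.{u} → Set (Interp S),
    K.IsSolution μ U X ∧ M = ⋂ α ∈ Set.Iio μ, X α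

/-- `M` is a dynamic MKNF model of the updatable dynamic hybrid knowledge base `K`: it is one with
respect to some update-enabling splitting sequence. -/
def IsDynamicMKNFModel (K : DynamicKB D n) (M : Set (Interp S)) : Prop :=
  ∃ (μ : Ordinal.{u}) (U : Ordinal.{u} → Set S.Pred),
    K.IsUpdateEnabling μ U ∧ K.IsDynamicMKNFModelWrt μ U M

end DynamicKB

end Splitting

end HybridUpdate

namespace HybridUpdate

/-! ### Dynamic stable models in terms of supported literals. -/

section Stratification

variable {S : Signature.{u, v}} {n : ℕ}

/-! A splitting sequence acts on programs only through the level of a predicate, the least index at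
which it enters the sequence. A splitting set that contains the head of a rule contains the whole
rule, so body levels never exceed head levels: the dynamic program is stratified, and each rule is
processed at the level of its head.

Without ontologies, every basic model is the set of supersets of a dynamic stable model. This also
covers the overlap where the programs consist of positive facts and a minimal change update is taken
instead: both semantics then yield the supersets of all the facts. So each member `X α` of a
solution is the set of supersets of some `A α`, whose atoms have level `α`; at a nonlimit index, `A
α` is stable for the rules of that level once their lower body literals have been evaluated
(`program_bottom_zero`, `program_reduct`). Limit levels contain no predicate.

Let `I` be the union of the `A α`. Rejection and default assumptions only compare rules whose heads
have the same atom, hence the same level, so stability can be checked level by level, and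
`isDynamicStableModel_of_levels` makes `I` stable for the whole program. For the converse some
splitting sequence suffices, and the one-element sequence makes the whole knowledge base basic at
once. -/

theorem Rule.ext_of_mem {r r' : Rule S} (hh : r.head = r'.head)
    (hb : ∀ L, L ∈ r.body ↔ L ∈ r'.body) : r = r' := by
  obtain ⟨h, b⟩ := r
  obtain ⟨h', b'⟩ := r'
  obtain rfl : h = h' := hh
  obtain rfl : b = b' := Finset.ext hb
  rfl

theorem mem_extended {I : Interp S} {L : Literal S} : L ∈ extended I ↔ L.Holds I := by
  cases L <;> simp [extended, Literal.Holds]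

theorem leastModel_subset {P : Program S} {J : Set (Literal S)}
    (h : ∀ r ∈ P, (∀ L ∈ r.body, L ∈ J) → r.head ∈ J) : leastModel P ⊆ J :=
  Set.sInter_subset_of_mem h

theorem head_mem_leastModel {P : Program S} {r : Rule S} (hr : r ∈ P)
    (h : ∀ L ∈ r.body, L ∈ leastModel P) : r.head ∈ leastModel P :=
  fun J hJ => hJ r hr fun L hL => h L hL J hJ

/-- The program `P` contains a rule with head `L` whose body is true in `I`. -/
def Supports (P : Program S) (I : Interp S) (L : Literal S) : Prop :=
  ∃ r ∈ P, r.head = L ∧ r.BodyHolds I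

/-- The residual program whose least model decides whether `I` is a dynamic stable model of `P`. -/
def residual (P : Fin n → Program S) (I : Interp S) : Program S :=
  {r | (∃ i, r ∈ P i ∧ ∀ j, i ≤ j → ¬ Supports (P j) I r.head.compl) ∨
    ∃ p, r = ⟨.dneg p, ∅⟩ ∧ ∀ j, ¬ Supports (P j) I (.pos p)}

theorem Literal.compl_eq_comm {L L' : Literal S} : L = L'.compl ↔ L' = L.compl := by
  cases L <;> cases L' <;> simp [Literal.compl, eq_comm]

theorem Literal.pred_compl (L : Literal S) : L.compl.pred = L.pred := by
  cases L <;> rfl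

theorem mem_rejected_iff {P : Fin n → Program S} {I : Interp S} {o : Fin n × Rule S} :
    o ∈ rejected P I ↔ o.2 ∈ P o.1 ∧ ∃ j, o.1 ≤ j ∧ Supports (P j) I o.2.head.compl := by
  simp only [rejected, Supports, Rule.Conflicts, Set.mem_ofPred_eq]
  refine and_congr_right fun _ => exists_congr fun j => ⟨?_, ?_⟩
  · rintro ⟨r', hr', hj, hc, hb⟩
    exact ⟨hj, r', hr', Literal.compl_eq_comm.1 hc, hb⟩
  · rintro ⟨hj, r', hr', hc, hb⟩
    exact ⟨r', hr', hj, Literal.compl_eq_comm.1 hc, hb⟩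

/-- Whether an occurrence is rejected depends only on its index and its head, so rejection and
defaults both become statements about `Supports`, the one notion that has to be transferred between
levels. -/
theorem isDynamicStableModel_iff {P : Fin n → Program S} {I : Interp S} :
    IsDynamicStableModel P I ↔ extended I = leastModel (residual P I) := by
  have : Prod.snd '' (allRules P \ rejected P I) ∪ defaults P I = residual P I := by
    ext r
    refine or_congr ⟨?_, ?_⟩ ⟨?_, ?_⟩
    · rintro ⟨o, ⟨ho, hn⟩, rfl⟩
      rw [mem_rejected_iff] at hn
      exact ⟨o.1, ho, fun j hj hs => hn ⟨ho, j, hj, hs⟩⟩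
    · rintro ⟨i, hi, hn⟩
      refine ⟨(i, r), ⟨hi, fun h => ?_⟩, rfl⟩
      obtain ⟨-, j, hj, hs⟩ := mem_rejected_iff.1 h
      exact hn j hj hs
    · rintro ⟨p, rfl, hn⟩
      exact ⟨p, rfl, fun j ⟨r, hr, h⟩ => hn ⟨(j, r), hr, h⟩⟩
    · rintro ⟨p, rfl, hn⟩
      exact ⟨p, rfl, fun ⟨o, ho, h⟩ => hn o.1 ⟨o.2, ho, h⟩⟩
  rw [IsDynamicStableModel, this]

/-- Every atom of a dynamic stable model is the head of some rule. -/
theorem IsDynamicStableModel.exists_head {P : Fin n → Program S} {I : Interp S}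
    (h : IsDynamicStableModel P I) {p : GroundAtom S} (hp : p ∈ I) :
    ∃ i, ∃ r ∈ P i, r.head = .pos p := by
  rw [isDynamicStableModel_iff] at h
  have hmem : Literal.pos p ∈ leastModel (residual P I) := h ▸ mem_extended.2 hp
  have hsub : leastModel (residual P I) ⊆ {L | ∃ r ∈ residual P I, r.head = L} :=
    leastModel_subset fun r hr _ => ⟨r, hr, rfl⟩
  obtain ⟨r, ⟨i, hi, -⟩ | ⟨q, rfl, -⟩, hr⟩ := hsub hmem
  · exact ⟨i, r, hi, hr⟩
  · cases hr

/-- A dynamic logic program that consists of positive facts has the set of these facts as a dynamic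
stable model. -/
theorem isDynamicStableModel_of_facts {P : Fin n → Program S}
    (h : ∀ i, ∀ r ∈ P i, r.IsPositive ∧ r.IsFact) :
    IsDynamicStableModel P {p | ∃ i, ∃ r ∈ P i, r.head = .pos p} := by
  rw [isDynamicStableModel_iff]
  refine Set.Subset.antisymm (fun L hL => ?_) (leastModel_subset ?_)
  · rw [mem_extended] at hL
    cases L with
    | pos p =>
      obtain ⟨i, r, hr, hp⟩ := hL
      have hb : r.body = ∅ := (h i r hr).2
      rw [← hp]
      refine head_mem_leastModel (Or.inl ⟨i, hr, ?_⟩) (by simp [hb])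
      -- Two positive heads never conflict, so nothing is rejected.
      rintro j - ⟨r', hr', hc, -⟩
      obtain ⟨q, hq⟩ := (h j r' hr').1
      rw [hp, hq] at hc
      cases hc
    | dneg p =>
      refine head_mem_leastModel (r := ⟨.dneg p, ∅⟩) (Or.inr ⟨p, rfl, ?_⟩) (by simp)
      rintro j ⟨r, hr, hp, -⟩
      exact hL ⟨j, r, hr, hp⟩
  · rintro r (⟨i, hr, -⟩ | ⟨p, rfl, hn⟩) -
    · obtain ⟨p, hp⟩ := (h i r hr).1
      rw [hp, mem_extended]
      exact ⟨i, r, hr, hp⟩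
    · rw [mem_extended]
      rintro ⟨i, r, hr, hp⟩
      refine hn i ⟨r, hr, hp, fun L hL => ?_⟩
      have hb : r.body = ∅ := (h i r hr).2
      simp [hb] at hL

/-! ### Stratified programs are solved level by level. -/

variable {ι : Type*}

/-- The atoms of `I` at level `a`. -/
def levelPart (lvl : S.Pred → ι) (I : Interp S) (a : ι) : Interp S :=
  {p ∈ I | lvl p.pred = a}

theorem holds_levelPart {lvl : S.Pred → ι} {I : Interp S} {a : ι} {L : Literal S}
    (h : lvl L.pred = a) : L.Holds (levelPart lvl I a) ↔ L.Holds I := by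
  cases L <;> simp_all [levelPart, Literal.Holds, Literal.pred]

variable [LinearOrder ι]

/-- The rules of `P` whose heads are at level `a`, after evaluating in `I` the part of their bodies
that is below level `a`. -/
def levelProgram (lvl : S.Pred → ι) (I : Interp S) (a : ι) (P : Program S) : Program S :=
  {r' | ∃ r ∈ P, lvl r.head.pred = a ∧ (∀ L ∈ r.body, lvl L.pred < a → L.Holds I) ∧
    r'.head = r.head ∧ ∀ L, L ∈ r'.body ↔ L ∈ r.body ∧ ¬ lvl L.pred < a}

theorem exists_filter (lvl : S.Pred → ι) (a : ι) (r : Rule S) :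
    ∃ r' : Rule S, r'.head = r.head ∧ ∀ L, L ∈ r'.body ↔ L ∈ r.body ∧ ¬ lvl L.pred < a := by
  classical
  exact ⟨⟨r.head, r.body.filter fun L => ¬ lvl L.pred < a⟩, rfl, fun L => by simp⟩

/-- Body literals lie at or below the level of the head: those strictly below were evaluated in `I`,
and on those at level `a` the interpretations `I` and `levelPart lvl I a` agree. Rejection and
defaults for heads of level `a` are therefore unchanged. -/
theorem supports_levelProgram {lvl : S.Pred → ι} {I : Interp S} {P : Program S}
    (hP : ∀ r ∈ P, ∀ L ∈ r.body, lvl L.pred ≤ lvl r.head.pred) {a : ι} {L : Literal S}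
    (hL : lvl L.pred = a) :
    Supports (levelProgram lvl I a P) (levelPart lvl I a) L ↔ Supports P I L := by
  constructor
  · rintro ⟨r', ⟨r, hr, hra, hlow, hhead, hbody⟩, hr'L, hholds⟩
    refine ⟨r, hr, hhead ▸ hr'L, fun L' hL' => ?_⟩
    by_cases hlt : lvl L'.pred < a
    · exact hlow L' hL' hlt
    · have heq : lvl L'.pred = a := le_antisymm (hra ▸ hP r hr L' hL') (not_lt.1 hlt)
      exact (holds_levelPart heq).1 (hholds L' ((hbody L').2 ⟨hL', hlt⟩))
  · rintro ⟨r, hr, rfl, hholds⟩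
    obtain ⟨r', hhead, hbody⟩ := exists_filter lvl a r
    refine ⟨r', ⟨r, hr, hL, fun L' hL' _ => hholds L' hL', hhead, hbody⟩, hhead, fun L' hL' => ?_⟩
    obtain ⟨hL'r, hlt⟩ := (hbody L').1 hL'
    have heq : lvl L'.pred = a := le_antisymm (hL ▸ hP r hr L' hL'r) (not_lt.1 hlt)
    exact (holds_levelPart heq).2 (hholds L' hL'r)

/-- If a dynamic logic program is stratified by `lvl` and each level of `I` is a dynamic stable
model of the corresponding level of the program, then `I` is a dynamic stable model. -/
theorem isDynamicStableModel_of_levels [WellFoundedLT ι] (lvl : S.Pred → ι)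
    {P : Fin n → Program S} {I : Interp S}
    (hP : ∀ i, ∀ r ∈ P i, ∀ L ∈ r.body, lvl L.pred ≤ lvl r.head.pred)
    (h : ∀ Q, IsDynamicStableModel (fun i => levelProgram lvl I (lvl Q) (P i))
      (levelPart lvl I (lvl Q))) :
    IsDynamicStableModel P I := by
  simp only [isDynamicStableModel_iff] at h ⊢
  refine Set.Subset.antisymm ?_ (leastModel_subset ?_)
  · suffices H : ∀ a, ∀ L : Literal S, lvl L.pred = a → L.Holds I →
        L ∈ leastModel (residual P I) from fun L hL => H _ L rfl (mem_extended.1 hL)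
    intro a
    induction a using WellFoundedLT.induction with
    | ind a ih =>
    intro L hL hholds
    subst hL
    have hmem := mem_extended.2 ((holds_levelPart (lvl := lvl) rfl).2 hholds)
    rw [h L.pred] at hmem
    -- The guard on the level is essential: in the program of one level, every atom of another level
    -- is unsupported and hence false by default, even if it belongs to `I`.
    have hsub : leastModel (residual (fun i => levelProgram lvl I (lvl L.pred) (P i))
        (levelPart lvl I (lvl L.pred))) ⊆
        {L' | lvl L'.pred = lvl L.pred → L' ∈ leastModel (residual P I)} := by
      refine leastModel_subset ?_
      rintro r' (⟨i, ⟨r, hr, hra, hlow, hhead, hbody⟩, hrej⟩ | ⟨p, rfl, hn⟩) hB hlev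
      · rw [hhead]
        refine head_mem_leastModel (Or.inl ⟨i, hr, fun j hj hs => hrej j hj ?_⟩) fun L' hL' => ?_
        · rw [hhead]
          exact (supports_levelProgram (hP j) (by rw [Literal.pred_compl, hra])).2 hs
        · by_cases hlt : lvl L'.pred < lvl L.pred
          · exact ih _ hlt L' rfl (hlow L' hL' hlt)
          · exact hB L' ((hbody L').2 ⟨hL', hlt⟩)
              (le_antisymm (hra ▸ hP i r hr L' hL') (not_lt.1 hlt))
      · exact head_mem_leastModel (r := ⟨.dneg p, ∅⟩) (Or.inr ⟨p, rfl, fun j hs =>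
          hn j ((supports_levelProgram (L := .pos p) (hP j) hlev).2 hs)⟩) (by simp)
    exact hsub hmem rfl
  -- It remains to see that `extended I` is closed under the residual rules. Filtering the body of
  -- such a rule gives a residual rule of its own level, whose least model agrees with `I` there; no
  -- induction is needed.
  · intro r hr hB
    rw [mem_extended]
    refine (holds_levelPart (lvl := lvl) rfl).1 (mem_extended.1 ?_)
    rw [h r.head.pred]
    obtain ⟨i, hi, hrej⟩ | ⟨p, rfl, hn⟩ := hr
    · obtain ⟨r', hhead, hbody⟩ := exists_filter lvl (lvl r.head.pred) r
      rw [← hhead]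
      refine head_mem_leastModel (Or.inl ⟨i, ⟨r, hi, by rw [hhead], fun L hL _ =>
        mem_extended.1 (hB L hL), hhead, by rwa [hhead]⟩, fun j hj hs => hrej j hj ?_⟩)
        fun L hL => ?_
      · rw [hhead] at hs
        exact (supports_levelProgram (hP j) (by rw [Literal.pred_compl])).1 hs
      · obtain ⟨hLr, hlt⟩ := (hbody L).1 hL
        rw [hhead, ← h r.head.pred, mem_extended]
        exact (holds_levelPart (le_antisymm (hP i r hi L hLr) (not_lt.1 hlt))).2
          (mem_extended.1 (hB L hLr))
    · exact head_mem_leastModel (r := ⟨.dneg p, ∅⟩) (Or.inr ⟨p, rfl, fun j hs =>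
        hn j ((supports_levelProgram (hP j) rfl).1 hs)⟩) (by simp)

end Stratification

/-! ### Minimal change updates by sets of atoms. -/

section MinimalChange

variable {S : Signature.{u, v}}

theorem mod_atoms (A : Set (GroundAtom S)) :
    mod {φ | ∃ p ∈ A, φ = p.toSentence} = {J | A ⊆ J} := by
  refine Set.Subset.antisymm ?_ fun J hJ => ?_
  · rintro J ⟨M, hM, hJ⟩ p hp
    exact hM _ ⟨p, hp, rfl⟩ J hJ
  · refine ⟨{J | A ⊆ J}, ?_, hJ⟩
    rintro φ ⟨p, hp, rfl⟩ I hI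
    exact hI hp

/-- If `J` misses some `p ∈ A`, it is not closest to any `I ⊇ A`, since `insert p J` removes the
difference at `p` and changes nothing else. Conversely, a `J` containing both sets is at distance
zero from itself. -/
theorem update_setOf_subset (A B : Interp S) :
    update {J | A ⊆ J} {J | B ⊆ J} = {J | A ∪ B ⊆ J} := by
  ext J
  simp only [update, Set.mem_iUnion, Set.mem_ofPred_eq, exists_prop, Set.union_subset_iff]
  constructor
  · rintro ⟨I, hI, hB, hmin⟩
    refine ⟨fun p hp => ?_, hB⟩
    by_contra hpJ
    refine hmin ⟨insert p J, hB.trans (Set.subset_insert p J), fun P q hq => ?_, fun hc => ?_⟩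
    · have hpI := hI hp
      simp only [diff, Set.mem_union, Set.mem_sdiff, Set.mem_ofPred_eq, Set.mem_insert_iff] at hq ⊢
      by_cases hqp : q = p
      · subst hqp; tauto
      · tauto
    · have hpd : p ∈ diff p.pred I J := Or.inl ⟨⟨hI hp, rfl⟩, fun h => hpJ h.1⟩
      have := hc p.pred hpd
      have hpI := hI hp
      simp [diff, hpI] at this
  · rintro ⟨hA, hB⟩
    refine ⟨J, hA, hB, ?_⟩
    rintro ⟨J', -, -, hn⟩
    refine hn fun P q hq => ?_
    simp [diff] at hq

theorem updateSeq_setOf_subset {n : ℕ} (A : Fin n → Interp S) :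
    updateSeq (fun i => {J | A i ⊆ J}) = {J | (⋃ i, A i) ⊆ J} := by
  induction n with
  | zero => simp [updateSeq]
  | succ k ih =>
    rw [updateSeq, ih fun i => A i.castSucc, update_setOf_subset]
    ext J
    simp [Fin.forall_fin_succ']

end MinimalChange

/-! ### Basic models without ontologies, and the trivial splitting sequence. -/

section Solutions

variable {S : Signature.{u, v}} {D : DescriptionLogic.{u, v, w} S} {n : ℕ}

/-- On a dynamic hybrid knowledge base without ontologies, every basic dynamic MKNF model is
given by a dynamic stable model. -/
theorem DynamicKB.IsBasicDynamicMKNFModel.exists_stable {K : DynamicKB D n}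
    {M : Set (Interp S)} (hM : K.IsBasicDynamicMKNFModel M) (hK : ∀ i, (K i).ontology = ∅) :
    ∃ I : Interp S, IsDynamicStableModel (fun i => (K i).program) I ∧ M = {J | I ⊆ J} := by
  obtain ⟨-, ⟨hO, hM, -⟩ | ⟨-, h⟩⟩ := hM
  -- Each theory is now a set of atoms, so the update model is the set of supersets of their union,
  -- which is also a stable model.
  · refine ⟨_, isDynamicStableModel_of_facts hO, ?_⟩
    have hth : ∀ i, (K i).theory = {φ | ∃ p ∈ {p | ∃ r ∈ (K i).program, r.head = .pos p},
        φ = GroundAtom.toSentence p} := by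
      intro i
      ext φ
      simp only [HybridKB.theory, hK, Set.image_empty, Set.empty_union, Set.mem_ofPred_eq]
      exact ⟨fun ⟨r, hr, p, hp, h⟩ => ⟨p, ⟨r, hr, hp⟩, h⟩,
        fun ⟨p, ⟨r, hr, hp⟩, h⟩ => ⟨r, hr, p, hp, h⟩⟩
    simp only [hth, mod_atoms, updateSeq_setOf_subset] at hM
    rw [hM]
    ext J
    exact ⟨fun h p ⟨i, hp⟩ => h (Set.mem_iUnion.2 ⟨i, hp⟩),
      fun h => Set.iUnion_subset fun i p hp => h ⟨i, hp⟩⟩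
  · exact h

theorem DynamicKB.isBasicDynamicMKNFModel_of_stable {K : DynamicKB D n}
    (hK : ∀ i, (K i).ontology = ∅) {I : Interp S}
    (hI : IsDynamicStableModel (fun i => (K i).program) I) :
    K.IsBasicDynamicMKNFModel {J | I ⊆ J} :=
  ⟨⟨I, Set.Subset.refl I⟩, Or.inr ⟨hK, I, hI, rfl⟩⟩

/-- The family of supersets has the least element `A`, which alone decides whether an atom is known
and also witnesses that an atom is not known. -/
theorem models_setOf_subset_iff (A : Interp S) (T : Set (Literal S)) :
    Models {J | A ⊆ J} {φ | ∃ L ∈ T, φ = L.toMKNF} ↔ ∀ L ∈ T, L.Holds A := by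
  constructor
  · intro h L hL
    have h' := h _ ⟨L, hL, rfl⟩ A (Set.Subset.refl A)
    cases L with
    | pos p => exact h' A (Set.Subset.refl A)
    | dneg p =>
      obtain ⟨J, hJ, hp⟩ := h'
      exact fun hpA => hp (hJ hpA)
  · rintro h φ ⟨L, hL, rfl⟩ I -
    have h' := h L hL
    cases L with
    | pos p => exact fun J hJ => hJ h'
    | dneg p => exact ⟨A, Set.Subset.refl A, h'⟩

theorem HybridKB.bottom_univ (K : HybridKB D) : K.bottom Set.univ = K := by
  simp [HybridKB.bottom]

/-- Without ontologies, the one-element sequence whose only member is the set of all predicate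
symbols is update-enabling. -/
theorem DynamicKB.isUpdateEnabling_univ {K : DynamicKB D n} (hK : ∀ i, (K i).ontology = ∅) :
    K.IsUpdateEnabling 1 fun _ => Set.univ where
  isSplittingSequence :=
    { pos := zero_lt_one
      monotone := fun _ _ _ _ => subset_rfl
      continuous := fun α hα hlim => by
        rw [Order.lt_one_iff] at hα
        exact absurd isMin_bot (hα ▸ hlim.1)
      splitting := fun i α _ => ⟨fun _ _ _ => Set.subset_univ _, fun _ _ _ => Set.subset_univ _⟩
      exhaustive := by
        refine Set.eq_univ_of_forall fun P => ?_
        simp only [Set.mem_iUnion]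
        exact ⟨0, Set.mem_Iio.2 zero_lt_one, trivial⟩ }
  reducible_zero := Or.inr fun i => by
    rw [DynamicKB.bottom, HybridKB.bottom_univ]
    exact hK i
  reducible_succ := fun α hα => absurd hα (by simp)

theorem DynamicKB.isDynamicMKNFModelWrt_univ {K : DynamicKB D n} {M : Set (Interp S)}
    (hM : K.IsBasicDynamicMKNFModel M) :
    K.IsDynamicMKNFModelWrt 1 (fun _ => Set.univ) M := by
  refine ⟨hM.1, fun _ => M, ⟨fun _ _ => hM.1, ?_, fun α hα => absurd hα (by simp), ?_⟩, ?_⟩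
  · have : K.bottom Set.univ = K := funext fun i => (K i).bottom_univ
    rwa [this]
  · intro α hα hlim
    rw [Order.lt_one_iff] at hα
    exact absurd isMin_bot (hα ▸ hlim.1)
  · ext J
    simp only [Set.mem_iInter]
    exact ⟨fun h _ _ => h, fun h => h 0 (Set.mem_Iio.2 zero_lt_one)⟩

/-! ### Levels of predicates along a splitting sequence. -/

/-- The least index at which the predicate symbol `P` occurs in the sequence `U`. -/
noncomputable def level (U : Ordinal.{u} → Set S.Pred) (P : S.Pred) : Ordinal.{u} :=
  sInf {α | P ∈ U α}

namespace DynamicKB.IsSplittingSequence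

variable {K : DynamicKB D n} {μ : Ordinal.{u}} {U : Ordinal.{u} → Set S.Pred}

theorem exists_mem (hU : K.IsSplittingSequence μ U) (P : S.Pred) : ∃ α < μ, P ∈ U α := by
  have := hU.exhaustive ▸ Set.mem_univ P
  simpa using this

theorem mem_level (hU : K.IsSplittingSequence μ U) (P : S.Pred) : P ∈ U (level U P) := by
  obtain ⟨α, -, hα⟩ := hU.exists_mem P
  -- Exhaustiveness makes the set nonempty, so the infimum is attained and the default value of an
  -- empty infimum plays no role.
  exact csInf_mem (s := {α | P ∈ U α}) ⟨α, hα⟩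

theorem level_lt (hU : K.IsSplittingSequence μ U) (P : S.Pred) : level U P < μ := by
  obtain ⟨α, hμ, hα⟩ := hU.exists_mem P
  exact (csInf_le' (s := {α | P ∈ U α}) hα).trans_lt hμ

theorem mem_iff_level_le (hU : K.IsSplittingSequence μ U) {P : S.Pred} {α : Ordinal.{u}}
    (hα : α < μ) : P ∈ U α ↔ level U P ≤ α :=
  ⟨fun h => csInf_le' (s := {α | P ∈ U α}) h, fun h => hU.monotone _ _ h hα (hU.mem_level P)⟩

/-- By continuity, a predicate present at a limit index has entered earlier. This excludes the
indices at which a solution is constrained to be `Set.univ` and carries no information about the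
program. -/
theorem not_isSuccLimit_level (hU : K.IsSplittingSequence μ U) (P : S.Pred) :
    ¬ Order.IsSuccLimit (level U P) := by
  intro hlim
  have := hU.continuous _ (hU.level_lt P) hlim ▸ hU.mem_level P
  simp only [Set.mem_iUnion, Set.mem_Iio, exists_prop] at this
  obtain ⟨β, hβ, hP⟩ := this
  exact absurd hβ (not_lt.2 (csInf_le' (s := {α | P ∈ U α}) hP))

theorem level_body_le (hU : K.IsSplittingSequence μ U) {i : Fin n} {r : Rule S}
    (hr : r ∈ (K i).program) {L : Literal S} (hL : L ∈ r.body) :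
    level U L.pred ≤ level U r.head.pred := by
  have hμ := hU.level_lt r.head.pred
  rw [← hU.mem_iff_level_le hμ]
  exact (hU.splitting i _ hμ).2 r hr (hU.mem_level _) (Or.inr ⟨L, hL, rfl⟩)

theorem preds_subset_iff (hU : K.IsSplittingSequence μ U) {i : Fin n} {r : Rule S}
    (hr : r ∈ (K i).program) {α : Ordinal.{u}} (hα : α < μ) :
    r.preds ⊆ U α ↔ level U r.head.pred ≤ α := by
  rw [← hU.mem_iff_level_le hα]
  exact ⟨fun h => h (Set.mem_insert _ _), fun h => (hU.splitting i α hα).2 r hr h⟩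

/-- No level is below zero, so nothing is evaluated and bodies stay whole. -/
theorem program_bottom_zero (hU : K.IsSplittingSequence μ U) (I : Interp S) (i : Fin n) :
    (K.bottom (U 0) i).program = levelProgram (level U) I 0 (K i).program := by
  ext r'
  constructor
  · rintro ⟨hr, hpr⟩
    refine ⟨r', hr, ?_, fun L _ h => absurd h (by simp), rfl, fun L => by simp⟩
    simpa using (hU.preds_subset_iff hr hU.pos).1 hpr
  · rintro ⟨r, hr, hlev, -, hhead, hbody⟩
    obtain rfl : r' = r := Rule.ext_of_mem hhead fun L => by simp [hbody]
    exact ⟨hr, (hU.preds_subset_iff hr hU.pos).2 hlev.le⟩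

theorem mem_program_top_bottom_iff (hU : K.IsSplittingSequence μ U) {α : Ordinal.{u}}
    (hα : α + 1 < μ) {i : Fin n} {r : Rule S} :
    r ∈ (((K i).bottom (U (α + 1))).top (U α)).program ↔
      r ∈ (K i).program ∧ level U r.head.pred = α + 1 := by
  have hα' : α < μ := (Order.lt_add_one_iff.2 le_rfl).trans hα
  simp only [HybridKB.top, HybridKB.bottom, Set.mem_ofPred_eq, Set.mem_sdiff]
  by_cases hr : r ∈ (K i).program
  · simp only [hr, true_and, hU.preds_subset_iff hr hα, hU.preds_subset_iff hr hα']
    constructor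
    · rintro ⟨h1, h2⟩
      exact le_antisymm h1 (Order.add_one_le_of_lt (not_le.1 fun h => h2 ⟨h1, h⟩))
    · intro h
      rw [h]
      exact ⟨le_rfl, fun h' => absurd h'.2 (not_le.2 (Order.lt_add_one_iff.2 le_rfl))⟩
  · simp [hr]

/-- The rules of the top are those with head level `α + 1`, and membership in `U α` means level
below `α + 1`; hence the reduct evaluates and deletes exactly the body literals that `levelProgram`
does. -/
theorem program_reduct (hU : K.IsSplittingSequence μ U) (I : Interp S) {α : Ordinal.{u}}
    (hα : α + 1 < μ) (i : Fin n) :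
    ((K.bottom (U (α + 1))).reduct (U α) {J | {p ∈ I | level U p.pred ≤ α} ⊆ J} i).program =
      levelProgram (level U) I (α + 1) (K i).program := by
  have hα' : α < μ := (Order.lt_add_one_iff.2 le_rfl).trans hα
  ext r'
  simp only [DynamicKB.reduct, HybridKB.reduct, DynamicKB.bottom, levelProgram,
    Set.mem_ofPred_eq, hU.mem_program_top_bottom_iff hα, and_assoc]
  refine exists_congr fun r => and_congr_right fun _ => and_congr_right fun _ =>
    and_congr ?_ (and_congr_right fun _ => forall_congr' fun L => ?_)
  · have hset : {φ | ∃ L ∈ r.body, L.pred ∈ U α ∧ φ = L.toMKNF} =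
        {φ | ∃ L ∈ {L | L ∈ r.body ∧ L.pred ∈ U α}, φ = L.toMKNF} := by
      ext φ
      simp [and_assoc]
    rw [hset, models_setOf_subset_iff]
    simp only [Set.mem_ofPred_eq, and_imp, hU.mem_iff_level_le hα', Order.lt_add_one_iff]
    refine forall_congr' fun L => forall_congr' fun _ => forall_congr' fun hle => ?_
    -- A literal of level at most `α` has the same truth value in `I` and in its part up to level
    -- `α`.
    cases L with
    | pos p => exact ⟨fun h => h.1, fun h => ⟨h, hle⟩⟩
    | dneg p => exact ⟨fun h hp => h ⟨hp, hle⟩, fun h hp => h hp.1⟩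
  · rw [hU.mem_iff_level_le hα', Order.lt_add_one_iff]

end DynamicKB.IsSplittingSequence

theorem setOf_subset_injective {A B : Interp S} (h : {J | A ⊆ J} = {J | B ⊆ J}) : A = B :=
  Set.Subset.antisymm
    (show B ∈ {J | A ⊆ J} from h ▸ Set.Subset.refl B)
    (show A ∈ {J | B ⊆ J} from h ▸ Set.Subset.refl A)

/-! ### Gluing a solution into one dynamic stable model. -/

namespace DynamicKB

variable {K : DynamicKB D n} {μ : Ordinal.{u}} {U : Ordinal.{u} → Set S.Pred}
  {X : Ordinal.{u} → Set (Interp S)}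

theorem ontology_bottom (hK : ∀ i, (K i).ontology = ∅) (V : Set S.Pred) (i : Fin n) :
    (K.bottom V i).ontology = ∅ := by
  simp [bottom, HybridKB.bottom, hK]

theorem ontology_reduct (hK : ∀ i, (K i).ontology = ∅) (V : Set S.Pred) (Y : Set (Interp S))
    (i : Fin n) : (K.reduct V Y i).ontology = ∅ := by
  simp [reduct, HybridKB.reduct, HybridKB.top, hK]

/-- Each member of a solution is the set of the supersets of a set of atoms of the right level. -/
theorem IsSolution.exists_eq_setOf_subset (hK : ∀ i, (K i).ontology = ∅)
    (hU : K.IsSplittingSequence μ U) (hX : K.IsSolution μ U X) {α : Ordinal.{u}} (hα : α < μ) :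
    ∃ A : Interp S, X α = {J | A ⊆ J} ∧ ∀ p ∈ A, level U p.pred = α := by
  obtain rfl | ⟨β, rfl⟩ | hlim := α.zero_or_succ_or_isSuccLimit
  · obtain ⟨A, hA, hXA⟩ := hX.zero.exists_stable (ontology_bottom hK _)
    refine ⟨A, hXA, fun p hp => ?_⟩
    -- Atoms of a stable model are heads of rules, and these fix the level.
    obtain ⟨i, r, hr, hrp⟩ := hA.exists_head hp
    simpa [hrp, Literal.pred] using (hU.preds_subset_iff hr.1 hU.pos).1 hr.2
  · obtain ⟨A, hA, hXA⟩ := (hX.succ β hα).exists_stable (ontology_reduct (ontology_bottom hK _) _ _)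
    refine ⟨A, hXA, fun p hp => ?_⟩
    obtain ⟨i, r', ⟨r, hr, -, hhead, -⟩, hrp⟩ := hA.exists_head hp
    have := ((hU.mem_program_top_bottom_iff hα).1 hr).2
    rwa [← hhead, hrp] at this
  · exact ⟨∅, by simp [hX.limit α hα hlim], by simp⟩

theorem IsSolution.exists_stable (hK : ∀ i, (K i).ontology = ∅)
    (hU : K.IsSplittingSequence μ U) (hX : K.IsSolution μ U X) :
    ∃ I : Interp S, IsDynamicStableModel (fun i => (K i).program) I ∧
      ⋂ α ∈ Set.Iio μ, X α = {J | I ⊆ J} := by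
  -- Indices outside the sequence get the empty set, so that a generator can be chosen for every
  -- ordinal.
  have hex : ∀ α, ∃ A : Interp S, α < μ → X α = {J | A ⊆ J} ∧ ∀ p ∈ A, level U p.pred = α := by
    intro α
    by_cases hα : α < μ
    · obtain ⟨A, hA⟩ := hX.exists_eq_setOf_subset hK hU hα
      exact ⟨A, fun _ => hA⟩
    · exact ⟨∅, fun h => absurd h hα⟩
  choose A hA using hex
  -- As `A α` only has atoms of level `α`, this is the union of the `A α` for `α < μ`, and its level
  -- parts recover them.
  let I : Interp S := {p | p ∈ A (level U p.pred)}
  have hpart : ∀ α < μ, levelPart (level U) I α = A α := fun α hα => by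
    ext p
    constructor
    · rintro ⟨hp, rfl⟩
      exact hp
    · intro hp
      have hlev := (hA α hα).2 p hp
      exact ⟨show p ∈ A (level U p.pred) by rwa [hlev], hlev⟩
  refine ⟨I, isDynamicStableModel_of_levels (level U) (fun i r hr L hL => hU.level_body_le hr hL)
    fun Q => ?_, ?_⟩
  · have hμ := hU.level_lt Q
    have hnl := hU.not_isSuccLimit_level Q
    generalize level U Q = α at hμ hnl
    rw [hpart α hμ]
    obtain rfl | ⟨β, rfl⟩ | hlim := α.zero_or_succ_or_isSuccLimit
    · obtain ⟨B, hB, hXB⟩ := hX.zero.exists_stable (ontology_bottom hK _)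
      -- A family of supersets determines its generator, so the stable model is the chosen `A 0`.
      obtain rfl := setOf_subset_injective ((hA 0 hμ).1.symm.trans hXB)
      simpa only [hU.program_bottom_zero I] using hB
    -- The intersection passed to the reduct is generated by the part of `I` up to level `β`, as
    -- `program_reduct` requires.
    · have hinter : ⋂ η ∈ Set.Iic β, X η = {J | {p ∈ I | level U p.pred ≤ β} ⊆ J} := by
        have hlt : ∀ η ≤ β, η < μ := fun η hη => (Order.lt_add_one_iff.2 hη).trans hμ
        ext J
        simp only [Set.mem_iInter, Set.mem_Iic]
        constructor
        · rintro h p ⟨hp, hle⟩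
          have := h _ hle
          rw [(hA _ (hlt _ hle)).1] at this
          exact this hp
        · intro h η hη
          rw [(hA η (hlt η hη)).1]
          intro p hp
          rw [← hpart η (hlt η hη)] at hp
          exact h ⟨hp.1, hp.2.trans_le hη⟩
      have hs := hX.succ β hμ
      rw [hinter] at hs
      obtain ⟨B, hB, hXB⟩ := hs.exists_stable (ontology_reduct (ontology_bottom hK _) _ _)
      obtain rfl := setOf_subset_injective ((hA _ hμ).1.symm.trans hXB)
      simp only [hU.program_reduct I hμ] at hB
      exact hB
    · exact absurd hlim hnl
  · ext J
    simp only [Set.mem_iInter, Set.mem_Iio]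
    constructor
    · intro h p hp
      have := h _ (hU.level_lt p.pred)
      rw [(hA _ (hU.level_lt p.pred)).1] at this
      exact this hp
    · intro h α hα
      rw [(hA α hα).1]
      intro p hp
      rw [← hpart α hα] at hp
      exact h hp.1

end DynamicKB

end Solutions

end HybridUpdate

theorem mainTheorem6 {S : HybridUpdate.Signature.{u, v}}
    {D : HybridUpdate.DescriptionLogic.{u, v, w} S} {n : ℕ} (K : HybridUpdate.DynamicKB D n)
    (hK : ∀ i, (K i).ontology = ∅) :
    HybridUpdate.DynamicKB.IsUpdatable K ∧
      ∀ M : Set (HybridUpdate.Interp S),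
        HybridUpdate.DynamicKB.IsDynamicMKNFModel K M ↔
          ∃ I : HybridUpdate.Interp S,
            HybridUpdate.IsDynamicStableModel (fun i => (K i).program) I ∧ M = {J | I ⊆ J} := by
  refine ⟨⟨1, _, HybridUpdate.DynamicKB.isUpdateEnabling_univ hK⟩, fun M => ⟨?_, ?_⟩⟩
  · rintro ⟨μ, U, hU, -, X, hX, rfl⟩
    exact hX.exists_stable hK hU.isSplittingSequence
  · rintro ⟨I, hI, rfl⟩
    exact ⟨1, _, HybridUpdate.DynamicKB.isUpdateEnabling_univ hK,
      HybridUpdate.DynamicKB.isDynamicMKNFModelWrt_univ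
        (HybridUpdate.DynamicKB.isBasicDynamicMKNFModel_of_stable hK hI)⟩
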